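/- Notation. Let $p$ be a prime and $G$ a finite group, $n=|G|=p^bm$ with $p\nmid m$, and $\mathbb{Q}_k=\mathbb{Q}(e^{2\pi i/k})$. Fix a maximal ideal of the ring of algebraic integers containing $p$, with respect to which $p$-blocks, defect groups and Brauer correspondents are taken as usual. For a character $\chi$, the conductor $c(\chi)$ is the least positive integer $k$ such that all values of $\chi$ lie in $\mathbb{Q}_k$, and $\mathrm{lev}(\chi)=\nu_p(c(\chi))$. For a $p$-block $B$ of $G$, $\mathrm{Irr}_0(B)$ is the set of height-zero characters of $B$, i.e. those $\chi\in\mathrm{Irr}(B)$ with $\nu_p(\chi(1))=\min_{\psi\in\mathrm{Irr}(B)}\nu_p(\psi(1))$. Let $\mathcal{I}=\mathrm{Gal}(\mathbb{Q}_n/\mathbb{Q}_m)$ and $\mathcal{H}=\mathcal{I}\times\langle\sigma\rangle\le\mathrm{Gal}(\mathbb{Q}_n/\mathbb{Q})$, where $\sigma$ fixes $\mathbb{Q}_{p^b}$ elementwise and restricts to $\zeta\mapsto\zeta^p$ on the $m$-th roots of unity; let $\mathcal{H}_B$ be the subgroup of $\mathcal{H}$ fixing $B$, where $\tau$ acts on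 characters by $\chi^\tau(g)=\tau(\chi(g))$. Let $D$ be a defect group of $B$ and $b$ the Brauer correspondent of $B$ in $\mathbf{N}_G(D)$. Consider the following assertions. * $\mathrm{AMN}$ (Alperin--McKay--Navarro): there is a bijection ${}^*:\mathrm{Irr}_0(B)\to\mathrm{Irr}_0(b)$ with $(\chi^\tau)^*=(\chi^*)^\tau$ for all $\chi\in\mathrm{Irr}_0(B)$ and $\tau\in\mathcal{H}_B$. * $\mathrm{Lev}$: $\mathrm{lev}(\chi)=\mathrm{lev}(\chi_{\mathbf{N}_G(D)})$ for every $\chi\in\mathrm{Irr}_0(B)$ with $\mathrm{lev}(\chi)\ge 2$. * $\mathrm{Comb}$: there is a bijection ${}^*$ as in $\mathrm{AMN}$ such that moreover $\mathrm{lev}(\chi_{\mathbf{N}_G(D)})=\mathrm{lev}(\chi^*)$ for every $\chi\in\mathrm{Irr}_0(B)$ with $\mathrm{lev}(\chi)\ge 2$. The AMN conjecture, the level conjecture and the combined conjecture assert that $\mathrm{AMN}$, $\mathrm{Lev}$ and $\mathrm{Comb}$, respectively, hold for all $p$, $G$, $B$ and $D$. Theorem. The AMN conjecture and the level conjecture together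 imply the combined conjecture. Conversely, the combined conjecture implies the level conjecture. Both implications hold block by block: for each fixed $p$, $G$, $B$, $D$ with Brauer correspondent $b$, $\mathrm{AMN}$ and $\mathrm{Lev}$ together imply $\mathrm{Comb}$, and $\mathrm{Comb}$ implies $\mathrm{Lev}$. -/

import Mathlib

universe u

/-- The ring `R` of algebraic integers in `ℂ`. -/
abbrev AlgInt : Type := integralClosure ℤ ℂ

/-- The set `Irr(G)` of (values of) irreducible complex characters of `G`. -/
def Irr (G : Type*) [Group G] : Set (G → ℂ) :=
  {χ | ∃ (d : ℕ) (ρ : Representation ℂ G (Fin d → ℂ)), ρ.IsIrreducible ∧ ρ.character = χ}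

/-- The degree `χ(1)` of a character, as a natural number. -/
noncomputable def charDegree {G : Type*} [Group G] (χ : G → ℂ) : ℕ := ⌊(χ 1).re⌋₊

/-- The restriction of a class function to a subgroup. -/
def resChar {G : Type*} [Group G] (H : Subgroup G) (χ : G → ℂ) : H → ℂ := fun h => χ h

section Level

/-- The cyclotomic field `ℚ_n = ℚ(exp(2πi/n))`, as a subfield of `ℂ` (used for `n ≥ 1`). -/
noncomputable def cycloField (n : ℕ) : IntermediateField ℚ ℂ :=
  IntermediateField.adjoin ℚ {Complex.exp (2 * Real.pi * Complex.I / n)}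

/-- The conductor of a set of cyclotomic integers: the least `n ≥ 1` with `S ⊆ ℚ_n`. -/
noncomputable def charConductor (S : Set ℂ) : ℕ :=
  sInf {n : ℕ | 0 < n ∧ S ⊆ (cycloField n : Set ℂ)}

/-- The `p`-rationality level `lev(χ) = ν_p(c(χ))`. -/
noncomputable def lev (p : ℕ) {G : Type*} (χ : G → ℂ) : ℕ :=
  padicValNat p (charConductor (Set.range χ))

end Level

section Blocks

/-- For a maximal ideal `M` of `R`, let `S = {r / s : r ∈ R, s ∈ R, s ∉ M}` be the localization of
`R` at `M` inside `ℂ`. This says that `z` lies in `S` and has image zero under the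
reduction map `S → R / M`, i.e. that `z = r / s` with `r ∈ M` and `s ∉ M`. -/
def ReducesToZero (M : Ideal AlgInt) (z : ℂ) : Prop :=
  ∃ r ∈ M, ∃ s : AlgInt, s ∉ M ∧ z = (r : ℂ) / (s : ℂ)

/-- The value of the central character `ω_χ` at the sum of the elements of `T ⊆ G`
(a union of conjugacy classes). -/
noncomputable def centralCharValue {G : Type*} [Group G] (χ : G → ℂ) (T : Set G) : ℂ :=
  (∑ᶠ y ∈ T, χ y) / χ 1

/-- `λ_χ = λ_ψ`: the central characters of `χ` and `ψ` agree modulo `M` on all class sums. -/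
def SameBlock {G : Type*} [Group G] (M : Ideal AlgInt) (χ ψ : G → ℂ) : Prop :=
  ∀ x : G, ReducesToZero M
    (centralCharValue χ (conjugatesOf x) - centralCharValue ψ (conjugatesOf x))

/-- `B` is (the set `Irr(B)` of irreducible characters of) a `p`-block of `G`, where `M` is a maximal
ideal of `R` containing `p`. -/
def IsBlock {G : Type*} [Group G] (M : Ideal AlgInt) (B : Set (G → ℂ)) : Prop :=
  ∃ χ ∈ Irr G, B = {ψ ∈ Irr G | SameBlock M χ ψ}

/-- The coefficient at `x` of the block idempotent
`f_B = ∑_{χ ∈ Irr(B)} (χ(1) / |G|) ∑_g χ(g⁻¹) g`, an element of `S`. -/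
noncomputable def blockIdemCoeff {G : Type*} [Group G] (B : Set (G → ℂ)) (x : G) : ℂ :=
  ∑ᶠ χ ∈ B, χ 1 / (Nat.card G : ℂ) * χ x⁻¹

/-- `D` is a defect group of the block `B`: it is a Sylow `p`-subgroup of `C_G(x)` for some `x`
lying in a defect class `K` of `B`, that is `λ_B(K̂) ≠ 0` and the
coefficient of `K̂` in the idempotent `e_B` (the reduction of `f_B` modulo `M`) is nonzero. -/
def IsDefectGroup {G : Type*} [Group G] (p : ℕ) (M : Ideal AlgInt) (B : Set (G → ℂ))
    (D : Subgroup G) : Prop :=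
  ∃ x : G, (∃ χ ∈ B, ¬ ReducesToZero M (centralCharValue χ (conjugatesOf x))) ∧
    ¬ ReducesToZero M (blockIdemCoeff B x) ∧
    ∃ P : Sylow p (Subgroup.centralizer ({x} : Set G)),
      D = (P : Subgroup (Subgroup.centralizer ({x} : Set G))).map
        (Subgroup.centralizer ({x} : Set G)).subtype

/-- `b^G = B` for a block `b` of the subgroup `H`: one has
`λ_B(K̂) = λ_b((K ∩ H)^)` for every conjugacy class `K` of `G`. -/
def InducedBlockEq {G : Type*} [Group G] (M : Ideal AlgInt) (H : Subgroup G)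
    (b : Set (H → ℂ)) (B : Set (G → ℂ)) : Prop :=
  ∀ ψ ∈ b, ∀ χ ∈ B, ∀ x : G, ReducesToZero M
    (centralCharValue ψ {y : H | (y : G) ∈ conjugatesOf x} -
      centralCharValue χ (conjugatesOf x))

/-- `b` is a block of `N_G(D)` with defect group `D` and `b^G = B`. -/
def IsBrauerCorrespondent {G : Type*} [Group G] (p : ℕ) (M : Ideal AlgInt) (D : Subgroup G)
    (B : Set (G → ℂ)) (b : Set (Subgroup.normalizer (D : Set G) → ℂ)) : Prop :=
  IsBlock M b ∧ IsDefectGroup p M b (D.subgroupOf (Subgroup.normalizer (D : Set G))) ∧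
    InducedBlockEq M (Subgroup.normalizer (D : Set G)) b B

open Classical in
/-- The Brauer correspondent of `B` in `N_G(D)`. For a block `B` with defect group `D` it exists and
is unique by Brauer's first main theorem, so that the second case does not occur. -/
noncomputable def brauerCorrespondent {G : Type*} [Group G] (p : ℕ) (M : Ideal AlgInt)
    (D : Subgroup G) (B : Set (G → ℂ)) : Set (Subgroup.normalizer (D : Set G) → ℂ) :=
  if h : ∃ b, IsBrauerCorrespondent p M D B b then h.choose else ∅

/-- The height of `χ ∈ Irr(B)`. -/
noncomputable def height {G : Type*} [Group G] (p : ℕ) (B : Set (G → ℂ)) (χ : G → ℂ) : ℕ :=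
  padicValNat p (charDegree χ) - sInf ((fun ψ => padicValNat p (charDegree ψ)) '' B)

/-- The set `Irr₀(B)` of height-zero characters of `B`. -/
def IrrZero {G : Type*} [Group G] (p : ℕ) (B : Set (G → ℂ)) : Set (G → ℂ) :=
  {χ ∈ B | height p B χ = 0}

end Blocks

section Galois

/-- The Galois group `Gal(ℚ_n / ℚ)`. -/
abbrev CycloGal (n : ℕ) : Type := cycloField n ≃ₐ[ℚ] cycloField n

open Classical in
/-- The Galois conjugate `χ^τ`, `χ^τ(g) = τ(χ(g))`, for `τ ∈ Gal(ℚ_n / ℚ)` and a function `χ` with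
values in `ℚ_n` (values outside `ℚ_n` are left unchanged; characters of a group whose
order divides `n` have none). -/
noncomputable def galConj {n : ℕ} {G : Type*} (τ : CycloGal n) (χ : G → ℂ) : G → ℂ := fun g =>
  if h : χ g ∈ cycloField n then (τ ⟨χ g, h⟩ : ℂ) else χ g

theorem galConj_one {n : ℕ} {G : Type*} (χ : G → ℂ) : galConj (1 : CycloGal n) χ = χ := by
  funext g
  by_cases h : χ g ∈ cycloField n <;> simp [galConj, h]

theorem galConj_mul {n : ℕ} {G : Type*} (τ υ : CycloGal n) (χ : G → ℂ) :
    galConj (τ * υ) χ = galConj τ (galConj υ χ) := by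
  funext g
  by_cases h : χ g ∈ cycloField n <;> simp [galConj, h]

/-- The subgroup `𝓘 = Gal(ℚ_n / ℚ_m)` of `Gal(ℚ_n / ℚ)`, where `m` is the `p'`-part of `n`. -/
noncomputable def galI (p n : ℕ) : Subgroup (CycloGal n) where
  carrier := {τ | ∀ z : cycloField n, (z : ℂ) ∈ cycloField (n / p ^ padicValNat p n) → τ z = z}
  one_mem' := fun _ _ => rfl
  mul_mem' := fun {τ υ} hτ hυ z hz => by
    rw [AlgEquiv.mul_apply, hυ z hz, hτ z hz]
  inv_mem' := fun {τ} hτ z hz => by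
    rw [AlgEquiv.aut_inv, AlgEquiv.symm_apply_eq, hτ z hz]

/-- `σ ∈ 𝓚 = Gal(ℚ_n / ℚ_{p^b})`, where `p^b` is the `p`-part of `n`, and `σ` restricts to the
Frobenius automorphism `ζ ↦ ζ^p` of `ℚ_m`, where `m` is the `p'`-part of `n`. -/
def IsFrobeniusLift (p n : ℕ) (σ : CycloGal n) : Prop :=
  (∀ z : cycloField n, (z : ℂ) ∈ cycloField (p ^ padicValNat p n) → σ z = z) ∧
    ∀ z : cycloField n, z ^ (n / p ^ padicValNat p n) = 1 → σ z = z ^ p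

/-- The subgroup `𝓗 = 𝓘 × ⟨σ⟩` of `Gal(ℚ_n / ℚ)`. -/
noncomputable def galH (p n : ℕ) : Subgroup (CycloGal n) :=
  galI p n ⊔ Subgroup.closure {σ | IsFrobeniusLift p n σ}

/-- The subgroup `𝓗_B` of `𝓗` fixing the block `B`. -/
noncomputable def galHB {G : Type*} (p n : ℕ) (B : Set (G → ℂ)) : Subgroup (CycloGal n) where
  carrier := {τ | τ ∈ galH p n ∧ galConj τ '' B = B}
  one_mem' := ⟨one_mem _, by simp [galConj_one]⟩
  mul_mem' := fun {τ υ} hτ hυ => ⟨mul_mem hτ.1 hυ.1, by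
    have h : (galConj (τ * υ) : (G → ℂ) → G → ℂ) = galConj τ ∘ galConj υ :=
      funext fun χ => galConj_mul τ υ χ
    rw [h, Set.image_comp, hυ.2, hτ.2]⟩
  inv_mem' := fun {τ} hτ => ⟨inv_mem hτ.1, by
    have h : (galConj τ⁻¹ : (G → ℂ) → G → ℂ) ∘ galConj τ = id :=
      funext fun χ => by
        rw [Function.comp_apply, ← galConj_mul, inv_mul_cancel, galConj_one, id]
    conv_lhs => rw [← hτ.2]
    rw [← Set.image_comp, h, Set.image_id]⟩

end Galois

section Conjectures

/-- `f` restricts to an `𝓗_B`-equivariant bijection `Irr₀(B) → Irr₀(b)`. -/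
def IsEquivariantBijection {G : Type*} [Group G] (p : ℕ) (D : Subgroup G) (B : Set (G → ℂ))
    (b : Set (Subgroup.normalizer (D : Set G) → ℂ))
    (f : (G → ℂ) → (Subgroup.normalizer (D : Set G) → ℂ)) : Prop :=
  Set.BijOn f (IrrZero p B) (IrrZero p b) ∧
    ∀ τ ∈ galHB p (Nat.card G) B, ∀ χ ∈ IrrZero p B, f (galConj τ χ) = galConj τ (f χ)

/-- The assertion of the Alperin–McKay–Navarro conjecture for the block `B` with defect group `D`
and Brauer correspondent `b`. -/
def AMNFor {G : Type*} [Group G] (p : ℕ) (D : Subgroup G) (B : Set (G → ℂ))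
    (b : Set (Subgroup.normalizer (D : Set G) → ℂ)) : Prop :=
  ∃ f : (G → ℂ) → (Subgroup.normalizer (D : Set G) → ℂ), IsEquivariantBijection p D B b f

/-- The assertion of the level conjecture for the block `B` with defect group `D`: height-zero
characters of `B` of level at least `2` satisfy `lev(χ) = lev(χ_{N_G(D)})`. -/
def LevelFor {G : Type*} [Group G] (p : ℕ) (D : Subgroup G) (B : Set (G → ℂ)) : Prop :=
  ∀ χ ∈ IrrZero p B, 2 ≤ lev p χ →
    lev p χ = lev p (resChar (Subgroup.normalizer (D : Set G)) χ)

/-- The assertion of the combined conjecture for the block `B` with defect group `D` and Brauer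
correspondent `b`. -/
def CombinedFor {G : Type*} [Group G] (p : ℕ) (D : Subgroup G) (B : Set (G → ℂ))
    (b : Set (Subgroup.normalizer (D : Set G) → ℂ)) : Prop :=
  ∃ f : (G → ℂ) → (Subgroup.normalizer (D : Set G) → ℂ), IsEquivariantBijection p D B b f ∧
    ∀ χ ∈ IrrZero p B, 2 ≤ lev p χ →
      lev p (resChar (Subgroup.normalizer (D : Set G)) χ) = lev p (f χ)

/-- The Alperin–McKay–Navarro conjecture. -/
def AMNConjecture : Prop :=
  ∀ (p : ℕ) (_ : p.Prime) (M : Ideal AlgInt) (_ : M.IsMaximal) (_ : (p : AlgInt) ∈ M)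
    (G : Type u) [Group G] [Finite G] (B : Set (G → ℂ)) (D : Subgroup G),
    IsBlock M B → IsDefectGroup p M B D → AMNFor p D B (brauerCorrespondent p M D B)

/-- The conjecture that `lev(χ) = lev(χ_{N_G(D)})` for height-zero characters of level at least
`2` in blocks with defect group `D`. -/
def LevelConjecture : Prop :=
  ∀ (p : ℕ) (_ : p.Prime) (M : Ideal AlgInt) (_ : M.IsMaximal) (_ : (p : AlgInt) ∈ M)
    (G : Type u) [Group G] [Finite G] (B : Set (G → ℂ)) (D : Subgroup G),
    IsBlock M B → IsDefectGroup p M B D → LevelFor p D B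

/-- The combined conjecture. -/
def CombinedConjecture : Prop :=
  ∀ (p : ℕ) (_ : p.Prime) (M : Ideal AlgInt) (_ : M.IsMaximal) (_ : (p : AlgInt) ∈ M)
    (G : Type u) [Group G] [Finite G] (B : Set (G → ℂ)) (D : Subgroup G),
    IsBlock M B → IsDefectGroup p M B D → CombinedFor p D B (brauerCorrespondent p M D B)

end Conjectures

/-!
Every bijection `f` as in the Alperin–McKay–Navarro conjecture preserves levels
(`IsEquivariantBijection.lev_eq`). Given such an `f`, the equalities `lev χ = lev χ_N` and
`lev χ_N = lev (f χ)` are therefore equivalent, for `N` the normalizer of the defect group, and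
both implications follow.

Let `n = |G|`, let `m` be its `p'`-part, and let `𝓘 = Gal(ℚ_n / ℚ_m)`.

* Since `ℚ_j ∩ ℚ_k = ℚ_(j,k)` (`cycloField_inf`), a character with values in `ℚ_n` has level at
  most `e` exactly when its values lie in `ℚ_k` with `k = p ^ e * m`, that is, when it is fixed by
  the subgroup `Gal(ℚ_n / ℚ_k)` of `𝓘`. So its level is determined by its stabilizer in `𝓘`
  (`lev_eq_of_galConj_eq_iff`).
* The group `𝓘` acts trivially modulo `M` on the algebraic integers of `ℚ_n`
  (`exists_mem_ideal_eq_sub`), among which are the values of the central characters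
  (`isIntegral_centralCharValue`). Hence `𝓘` fixes every block, and `𝓘 ≤ 𝓗_B`
  (`IsBlock.galI_le_galHB`).
* So `f` commutes with the action of `𝓘`, and as it is injective on `Irr₀(B)`, the characters `χ`
  and `f χ` have the same stabilizer in `𝓘`.
-/

/-! ### Cyclotomic subfields of `ℂ` -/

/-- Over `ℚ`, being a cyclotomic extension does not depend on the algebra structure. This matters
because a subfield of a `ℚ`-algebra carries two such structures that are not definitionally equal. -/
theorem isCyclotomicExtension_rat_congr {S : Set ℕ} {K : Type*} [Field K] (a b : Algebra ℚ K)
    (h : @IsCyclotomicExtension S ℚ K _ _ a) : @IsCyclotomicExtension S ℚ K _ _ b :=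
  Subsingleton.elim a b ▸ h

theorem isCyclotomicExtension_adjoin_rat {L : Type*} [Field L] [Algebra ℚ L] {n : ℕ} [NeZero n]
    {ζ : L} (hζ : IsPrimitiveRoot ζ n) :
    IsCyclotomicExtension {n} ℚ (IntermediateField.adjoin ℚ {ζ}) :=
  isCyclotomicExtension_rat_congr _ _
    ((IntermediateField.isCyclotomicExtension_singleton_iff_eq_adjoin n ℚ L _ hζ).2 rfl)

instance cycloField_isCyclotomicExtension (n : ℕ) [NeZero n] :
    IsCyclotomicExtension {n} ℚ (cycloField n) :=
  isCyclotomicExtension_adjoin_rat (Complex.isPrimitiveRoot_exp n (NeZero.ne n))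

instance cycloField_numberField (n : ℕ) [NeZero n] : NumberField (cycloField n) :=
  IsCyclotomicExtension.numberField {n} ℚ (cycloField n)

instance cycloField_isAbelianGalois (n : ℕ) [NeZero n] : IsAbelianGalois ℚ (cycloField n) :=
  IsCyclotomicExtension.isAbelianGalois {n} ℚ (cycloField n)

theorem mem_cycloField_of_pow_eq_one {n : ℕ} (hn : n ≠ 0) {z : ℂ} (hz : z ^ n = 1) :
    z ∈ cycloField n := by
  have : NeZero n := ⟨hn⟩
  obtain ⟨k, -, rfl⟩ := (Complex.isPrimitiveRoot_exp n hn).eq_pow_of_pow_eq_one hz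
  exact pow_mem (IntermediateField.mem_adjoin_simple_self ℚ _) k

theorem cycloField_le_of_dvd {j k : ℕ} (hk : k ≠ 0) (h : j ∣ k) : cycloField j ≤ cycloField k := by
  have hj : j ≠ 0 := ne_zero_of_dvd_ne_zero hk h
  refine IntermediateField.adjoin_simple_le_iff.2 (mem_cycloField_of_pow_eq_one hk ?_)
  exact (Complex.isPrimitiveRoot_exp j hj).pow_eq_one_iff_dvd k |>.2 h

/-- The field `ℚ_k ∩ ℚ_n` as an intermediate field of `ℚ_n / ℚ`. -/
noncomputable def cycloSubfield (n k : ℕ) : IntermediateField ℚ (cycloField n) :=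
  (cycloField k).comap (RingHom.toRatAlgHom (algebraMap (cycloField n) ℂ))

theorem mem_cycloSubfield {n k : ℕ} {z : cycloField n} :
    z ∈ cycloSubfield n k ↔ (z : ℂ) ∈ cycloField k := Iff.rfl

theorem cycloSubfield_isCyclotomicExtension {n k : ℕ} (hn : n ≠ 0) (h : k ∣ n) :
    IsCyclotomicExtension {k} ℚ (cycloSubfield n k) := by
  have hk : k ≠ 0 := ne_zero_of_dvd_ne_zero hn h
  have : NeZero k := ⟨hk⟩
  have hζ := Complex.isPrimitiveRoot_exp k hk
  let ξ : cycloField n := ⟨_, mem_cycloField_of_pow_eq_one hn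
    ((hζ.pow_eq_one_iff_dvd n).2 h)⟩
  have hξ : IsPrimitiveRoot ξ k := IsPrimitiveRoot.of_map_of_injective
    (f := algebraMap (cycloField n) ℂ) hζ (algebraMap (cycloField n) ℂ).injective
  have heq : cycloSubfield n k = IntermediateField.adjoin ℚ {ξ} := by
    apply IntermediateField.map_injective (RingHom.toRatAlgHom (algebraMap (cycloField n) ℂ))
    rw [cycloSubfield, IntermediateField.map_comap_eq, IntermediateField.adjoin_map,
      Set.image_singleton, inf_eq_left.2]
    · rfl
    · exact fun z hz => ⟨⟨z, cycloField_le_of_dvd hn h hz⟩, rfl⟩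
  rw [heq]
  exact isCyclotomicExtension_adjoin_rat hξ

/-- The Dirichlet characters modulo `n` belonging to `ℚ_k` are those whose conductor divides `k`. -/
theorem mem_subgroupChar_cycloSubfield_iff {n k : ℕ} [NeZero n] (h : k ∣ n)
    (χ : DirichletCharacter ℂ n) :
    χ ∈ IsCyclotomicExtension.Rat.intermediateFieldEquivSubgroupChar n (cycloField n) ℂ
      (cycloSubfield n k) ↔ χ.conductor ∣ k := by
  have := cycloSubfield_isCyclotomicExtension (NeZero.ne n) h
  have : NeZero k := ⟨ne_zero_of_dvd_ne_zero (NeZero.ne n) h⟩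
  have : IsGalois ℚ (cycloSubfield n k) := IsCyclotomicExtension.isGalois {k} ℚ _
  exact IsCyclotomicExtension.Rat.mem_intermediateFieldEquivSubgroupChar_iff_conductor_dvd _ _ _ _
    h χ

/-- `ℚ_j ∩ ℚ_k = ℚ_(j,k)`: inside `ℚ_n`, with `n` the least common multiple of `j` and `k`, these
fields correspond to the groups of Dirichlet characters whose conductor divides `j`, `k` and
`(j,k)` respectively. -/
theorem cycloField_inf {j k : ℕ} (hj : j ≠ 0) (hk : k ≠ 0) :
    cycloField j ⊓ cycloField k = cycloField (j.gcd k) := by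
  have hl : j.lcm k ≠ 0 := Nat.lcm_ne_zero hj hk
  have : NeZero (j.lcm k) := ⟨hl⟩
  apply le_antisymm
  · rintro z ⟨hzj, hzk⟩
    have key : cycloSubfield (j.lcm k) j ⊓ cycloSubfield (j.lcm k) k
        = cycloSubfield (j.lcm k) (j.gcd k) := by
      apply (IsCyclotomicExtension.Rat.intermediateFieldEquivSubgroupChar (j.lcm k)
        (cycloField (j.lcm k)) ℂ).injective
      ext χ
      rw [OrderIso.map_inf, Subgroup.mem_inf,
        mem_subgroupChar_cycloSubfield_iff (Nat.dvd_lcm_left j k),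
        mem_subgroupChar_cycloSubfield_iff (Nat.dvd_lcm_right j k),
        mem_subgroupChar_cycloSubfield_iff ((Nat.gcd_dvd_left j k).trans (Nat.dvd_lcm_left j k)),
        Nat.dvd_gcd_iff]
    have hz : (⟨z, cycloField_le_of_dvd hl (Nat.dvd_lcm_left j k) hzj⟩ : cycloField (j.lcm k)) ∈
        cycloSubfield (j.lcm k) j ⊓ cycloSubfield (j.lcm k) k := ⟨hzj, hzk⟩
    rw [key] at hz
    exact hz
  · exact le_inf (cycloField_le_of_dvd hj (Nat.gcd_dvd_left j k))
      (cycloField_le_of_dvd hk (Nat.gcd_dvd_right j k))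

/-- If `S` lies in some `ℚ_n` with `n ≥ 1`, then the conductor `c` of `S` is attained, and
`S ⊆ ℚ_n` exactly when `c` divides `n`. -/
theorem subset_cycloField_iff_charConductor_dvd {S : Set ℂ} {n : ℕ} (hn : n ≠ 0)
    (hS : S ⊆ cycloField n) {k : ℕ} (hk : k ≠ 0) :
    S ⊆ cycloField k ↔ charConductor S ∣ k := by
  have hne : {n : ℕ | 0 < n ∧ S ⊆ (cycloField n : Set ℂ)}.Nonempty :=
    ⟨n, Nat.pos_of_ne_zero hn, hS⟩
  obtain ⟨hc, hSc⟩ := Nat.sInf_mem hne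
  change 0 < charConductor S at hc
  change S ⊆ cycloField (charConductor S) at hSc
  refine ⟨fun h => ?_, fun h => hSc.trans (cycloField_le_of_dvd hk h)⟩
  -- `S ⊆ ℚ_c ∩ ℚ_k = ℚ_(c,k)`, so `c ≤ (c,k)` by minimality of `c`.
  have hle : charConductor S ≤ (charConductor S).gcd k := by
    refine Nat.sInf_le ⟨Nat.gcd_pos_of_pos_left _ hc, fun z hz => ?_⟩
    have : z ∈ cycloField (charConductor S) ⊓ cycloField k := ⟨hSc hz, h hz⟩
    rwa [cycloField_inf hc.ne' hk] at this
  exact Nat.gcd_eq_left_iff_dvd.1 (Nat.le_antisymm (Nat.gcd_le_left _ hc) hle)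

/-- The `p`-part of the conductor of a subset of `ℚ_n` is read off from the fields between `ℚ_m`
and `ℚ_n`, where `m` is the `p'`-part of `n`. -/
theorem padicValNat_charConductor_le_iff {p : ℕ} (hp : p.Prime) {S : Set ℂ} {n : ℕ} (hn : n ≠ 0)
    (hS : S ⊆ cycloField n) {e : ℕ} :
    padicValNat p (charConductor S) ≤ e ↔
      S ⊆ cycloField (p ^ e * (n / p ^ padicValNat p n)) := by
  have : Fact p.Prime := ⟨hp⟩
  have hdvd : p ^ padicValNat p n ∣ n := pow_padicValNat_dvd
  have hm : n / p ^ padicValNat p n ≠ 0 :=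
    (Nat.div_pos (Nat.le_of_dvd (Nat.pos_of_ne_zero hn) hdvd) (pow_pos hp.pos _)).ne'
  have hpe : p ^ e ≠ 0 := (pow_pos hp.pos _).ne'
  have hcn := (subset_cycloField_iff_charConductor_dvd hn hS hn).1 hS
  have hc : charConductor S ≠ 0 := ne_zero_of_dvd_ne_zero hn hcn
  rw [subset_cycloField_iff_charConductor_dvd hn hS (mul_ne_zero hpe hm),
    ← Nat.factorization_def _ hp]
  have hmp : (n / p ^ padicValNat p n).factorization p = 0 := by
    rw [← Nat.factorization_def n hp]
    exact Nat.factorization_eq_zero_of_not_dvd (Nat.not_dvd_ordCompl hp hn)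
  constructor
  · intro h
    rw [← Nat.factorization_le_iff_dvd hc (mul_ne_zero hpe hm)]
    intro q
    rw [Nat.factorization_mul hpe hm, Finsupp.add_apply, hp.factorization_pow]
    by_cases hq : q = p
    · subst hq
      simpa using h.trans (Nat.le_add_right _ _)
    · have := (Nat.factorization_le_iff_dvd hc hn).2 hcn q
      rw [← Nat.factorization_def n hp, Nat.factorization_ordCompl]
      simpa [Finsupp.erase_ne hq, Finsupp.single_eq_of_ne hq] using this
  · intro h
    have := (Nat.factorization_le_iff_dvd hc (mul_ne_zero hpe hm)).2 h p
    rwa [Nat.factorization_mul hpe hm, Finsupp.add_apply, hp.factorization_pow, hmp,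
      Finsupp.single_eq_same, add_zero] at this

/-- The Galois correspondence for `ℚ_n / ℚ_k`. -/
theorem mem_cycloField_iff_forall_fixed {n : ℕ} (hn : n ≠ 0) (k : ℕ) (z : cycloField n) :
    (z : ℂ) ∈ cycloField k ↔
      ∀ τ : CycloGal n, (∀ y : cycloField n, (y : ℂ) ∈ cycloField k → τ y = y) → τ z = z := by
  have : NeZero n := ⟨hn⟩
  refine ⟨fun h τ hτ => hτ z h, fun h => ?_⟩
  rw [← mem_cycloSubfield, ← IsGalois.fixedField_fixingSubgroup (cycloSubfield n k),
    IntermediateField.mem_fixedField_iff]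
  exact fun τ hτ => h τ fun y hy => (IntermediateField.mem_fixingSubgroup_iff _ _).1 hτ y hy

/-- Every automorphism of a subfield `F` of `ℂ` extends to `ℂ`: it acts on the coefficients of the
polynomials in a transcendence basis of `ℂ` over `F`, and `ℂ` is an algebraic closure of the field
they generate. -/
theorem exists_ringEquiv_extending {F : IntermediateField ℚ ℂ} (τ : F ≃ₐ[ℚ] F) :
    ∃ σ : ℂ ≃+* ℂ, ∀ z : F, σ z = τ z := by
  obtain ⟨s, hs⟩ := exists_isTranscendenceBasis F ℂ
  have := IsAlgClosed.isAlgClosure_of_transcendence_basis _ hs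
  let e : Algebra.adjoin F (Set.range ((↑) : s → ℂ)) ≃+*
      Algebra.adjoin F (Set.range ((↑) : s → ℂ)) :=
    (hs.1.aevalEquiv.symm.toRingEquiv.trans
      (MvPolynomial.mapEquiv s τ.toRingEquiv)).trans hs.1.aevalEquiv.toRingEquiv
  refine ⟨IsAlgClosure.equivOfEquiv ℂ ℂ e, fun z => ?_⟩
  have h := IsAlgClosure.equivOfEquiv_algebraMap ℂ ℂ e
    (algebraMap F (Algebra.adjoin F (Set.range ((↑) : s → ℂ))) z)
  have he : e (algebraMap F _ z) = algebraMap F _ (τ z) := by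
    simp only [e, RingEquiv.trans_apply]
    have h1 : hs.1.aevalEquiv.symm.toRingEquiv (algebraMap F _ z) = MvPolynomial.C z :=
      hs.1.aevalEquiv.symm.commutes z
    rw [h1]
    have h2 : MvPolynomial.mapEquiv s τ.toRingEquiv (MvPolynomial.C z) = MvPolynomial.C (τ z) := by
      simp
    rw [h2]
    exact hs.1.aevalEquiv.commutes (τ z)
  rw [he] at h
  exact h

/-! ### Values and Galois conjugates of irreducible characters -/

/-- Character values are sums of `n`-th roots of unity. -/
theorem character_mem_cycloField {G : Type*} [Group G] {n : ℕ} (hn : n ≠ 0)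
    (hG : ∀ g : G, g ^ n = 1) {d : ℕ} (ρ : Representation ℂ G (Fin d → ℂ)) (g : G) :
    ρ.character g ∈ cycloField n := by
  rw [Representation.character, Module.End.trace_eq_sum_roots_charpoly_of_splits
    (IsAlgClosed.splits _)]
  refine multiset_sum_mem _ fun μ hμ => mem_cycloField_of_pow_eq_one hn ?_
  have hμ' : Module.End.HasEigenvalue (ρ g) μ :=
    Module.End.hasEigenvalue_iff_isRoot_charpoly _ _ |>.2 (Polynomial.isRoot_of_mem_roots hμ)
  obtain ⟨v, hv⟩ := hμ'.exists_hasEigenvector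
  have h := hv.pow_apply n
  rw [← map_pow, hG, map_one, Module.End.one_apply] at h
  refine (smul_left_injective ℂ hv.2 ?_).symm
  simpa using h

/-- A multiple `n` of the exponent of `G` is allowed, so that `n = |G|` also serves for the
characters of subgroups of `G`. -/
theorem apply_mem_cycloField_of_mem_Irr {G : Type*} [Group G] {n : ℕ} (hn : n ≠ 0)
    (hG : ∀ g : G, g ^ n = 1) {χ : G → ℂ} (hχ : χ ∈ Irr G) (g : G) : χ g ∈ cycloField n := by
  obtain ⟨d, ρ, -, rfl⟩ := hχ
  exact character_mem_cycloField hn hG ρ g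

theorem exists_apply_one_eq_natCast {G : Type*} [Group G] {χ : G → ℂ} (hχ : χ ∈ Irr G) :
    ∃ d : ℕ, χ 1 = d := by
  obtain ⟨d, ρ, -, rfl⟩ := hχ
  exact ⟨d, by simp⟩

/-- The representation obtained by applying a field automorphism to matrix entries. -/
noncomputable def twistRep {G : Type*} [Group G] {d : ℕ} (σ : ℂ ≃+* ℂ)
    (ρ : Representation ℂ G (Fin d → ℂ)) : Representation ℂ G (Fin d → ℂ) :=
  (Matrix.toLinAlgEquiv' : Matrix (Fin d) (Fin d) ℂ ≃ₐ[ℂ] _).toAlgHom.toMonoidHom.comp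
    ((σ.mapMatrix : Matrix (Fin d) (Fin d) ℂ ≃+* _).toMonoidHom.comp
      ((LinearMap.toMatrixAlgEquiv' : _ ≃ₐ[ℂ] Matrix (Fin d) (Fin d) ℂ).toAlgHom.toMonoidHom.comp
        ρ))

theorem twistRep_eq {G : Type*} [Group G] {d : ℕ} (σ : ℂ ≃+* ℂ)
    (ρ : Representation ℂ G (Fin d → ℂ)) (g : G) :
    twistRep σ ρ g = Matrix.toLin' ((LinearMap.toMatrix' (ρ g)).map σ) := rfl

theorem twistRep_apply {G : Type*} [Group G] {d : ℕ} (σ : ℂ ≃+* ℂ)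
    (ρ : Representation ℂ G (Fin d → ℂ)) (g : G) (v : Fin d → ℂ) :
    twistRep σ ρ g (σ ∘ v) = σ ∘ ρ g v := by
  have h : ρ g v = (LinearMap.toMatrix' (ρ g)).mulVec v := by
    rw [← Matrix.toLin'_apply, Matrix.toLin'_toMatrix']
  rw [twistRep_eq, Matrix.toLin'_apply, h]
  ext i
  exact (RingHom.map_mulVec (σ : ℂ →+* ℂ) _ v i).symm

theorem character_twistRep {G : Type*} [Group G] {d : ℕ} (σ : ℂ ≃+* ℂ)
    (ρ : Representation ℂ G (Fin d → ℂ)) : (twistRep σ ρ).character = σ ∘ ρ.character := by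
  ext g
  rw [Function.comp_apply, Representation.character, Representation.character, twistRep_eq,
    Matrix.trace_toLin'_eq, LinearMap.trace_eq_matrix_trace ℂ (Pi.basisFun ℂ (Fin d)) (ρ g),
    LinearMap.toMatrix_eq_toMatrix']
  simp [Matrix.trace, map_sum]

/-- The subrepresentation of the twist given by the image of a subrepresentation. -/
noncomputable def twistSubrep {G : Type*} [Group G] {d : ℕ} (σ : ℂ ≃+* ℂ)
    {ρ ρ' : Representation ℂ G (Fin d → ℂ)} (h : ∀ g v, ρ' g (σ ∘ v) = σ ∘ ρ g v)
    (W : Subrepresentation ρ) : Subrepresentation ρ' where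
  toSubmodule :=
    { carrier := {v | σ.symm ∘ v ∈ W.toSubmodule}
      zero_mem' := by
        have : σ.symm ∘ (0 : Fin d → ℂ) = 0 := by ext; simp
        simp [this]
      add_mem' := fun {v w} hv hw => by
        have : σ.symm ∘ (v + w) = σ.symm ∘ v + σ.symm ∘ w := by ext; simp
        simpa [this] using add_mem hv hw
      smul_mem' := fun c v hv => by
        have : σ.symm ∘ (c • v) = σ.symm c • (σ.symm ∘ v) := by ext; simp
        simpa [this] using W.toSubmodule.smul_mem (σ.symm c) hv }
  apply_mem_toSubmodule g v hv := by
    have h1 : σ ∘ (σ.symm ∘ v) = v := by ext; simp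
    have h2 := h g (σ.symm ∘ v)
    rw [h1] at h2
    have h3 : σ.symm ∘ (ρ' g v) = ρ g (σ.symm ∘ v) := by rw [h2]; ext; simp
    change σ.symm ∘ (ρ' g v) ∈ W.toSubmodule
    rw [h3]
    exact W.apply_mem_toSubmodule g hv

theorem mem_twistSubrep {G : Type*} [Group G] {d : ℕ} (σ : ℂ ≃+* ℂ)
    {ρ ρ' : Representation ℂ G (Fin d → ℂ)} (h : ∀ g v, ρ' g (σ ∘ v) = σ ∘ ρ g v)
    (W : Subrepresentation ρ) (v : Fin d → ℂ) :
    v ∈ twistSubrep σ h W ↔ σ.symm ∘ v ∈ W := Iff.rfl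

/-- Twisting by a field automorphism is an isomorphism on the lattices of subrepresentations. -/
noncomputable def twistSubrepIso {G : Type*} [Group G] {d : ℕ} (σ : ℂ ≃+* ℂ)
    (ρ : Representation ℂ G (Fin d → ℂ)) :
    Subrepresentation ρ ≃o Subrepresentation (twistRep σ ρ) where
  toFun := twistSubrep σ (twistRep_apply σ ρ)
  invFun := twistSubrep σ.symm fun g v => by
    have h := twistRep_apply σ ρ g (σ.symm ∘ v)
    have h1 : σ ∘ (σ.symm ∘ v) = v := by ext; simp
    rw [h1] at h
    rw [h]
    ext; simp
  left_inv W := by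
    refine SetLike.ext fun v => ?_
    have h1 : σ.symm ∘ (σ.symm.symm ∘ v) = v := by ext; simp
    rw [mem_twistSubrep, mem_twistSubrep, h1]
  right_inv W := by
    refine SetLike.ext fun v => ?_
    have h1 : σ.symm.symm ∘ (σ.symm ∘ v) = v := by ext; simp
    rw [mem_twistSubrep, mem_twistSubrep, h1]
  map_rel_iff' {W W'} := by
    refine ⟨fun h v hv => ?_, fun h v hv => h hv⟩
    have h1 : σ.symm ∘ (σ ∘ v) = v := by ext; simp
    have h2 := @h (σ ∘ v) (by
      change σ.symm ∘ (σ ∘ v) ∈ W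
      rwa [h1])
    change σ.symm ∘ (σ ∘ v) ∈ W' at h2
    rwa [h1] at h2

theorem comp_mem_Irr {G : Type*} [Group G] (σ : ℂ ≃+* ℂ) {χ : G → ℂ} (hχ : χ ∈ Irr G) :
    σ ∘ χ ∈ Irr G := by
  obtain ⟨d, ρ, hρ, rfl⟩ := hχ
  exact ⟨d, twistRep σ ρ, (twistSubrepIso σ ρ).symm.isSimpleOrder, character_twistRep σ ρ⟩

theorem galConj_eq_comp {G : Type*} {n : ℕ} {τ : CycloGal n} {σ : ℂ ≃+* ℂ}
    (hσ : ∀ z : cycloField n, σ z = τ z) {χ : G → ℂ} (hχ : ∀ g, χ g ∈ cycloField n) :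
    galConj τ χ = σ ∘ χ := by
  funext g
  rw [galConj, dif_pos (hχ g), Function.comp_apply, ← hσ]

theorem galConj_apply {G : Type*} {n : ℕ} (τ : CycloGal n) {χ : G → ℂ} {g : G}
    (h : χ g ∈ cycloField n) : galConj τ χ g = τ ⟨χ g, h⟩ := dif_pos h

theorem galConj_eq_self_iff {G : Type*} {n : ℕ} (τ : CycloGal n) {χ : G → ℂ}
    (hχ : ∀ g, χ g ∈ cycloField n) :
    galConj τ χ = χ ↔ ∀ g, τ ⟨χ g, hχ g⟩ = ⟨χ g, hχ g⟩ := by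
  rw [funext_iff]
  refine forall_congr' fun g => ?_
  rw [galConj_apply τ (hχ g), Subtype.ext_iff]

theorem charDegree_galConj {G : Type*} [Group G] {n : ℕ} (τ : CycloGal n) {χ : G → ℂ}
    (hχ : χ ∈ Irr G) : charDegree (galConj τ χ) = charDegree χ := by
  obtain ⟨d, hd⟩ := exists_apply_one_eq_natCast hχ
  have h : χ 1 ∈ cycloField n := hd ▸ natCast_mem _ d
  have h' : (⟨χ 1, h⟩ : cycloField n) = (d : cycloField n) := Subtype.ext hd
  rw [charDegree, charDegree, galConj_apply τ h, h', map_natCast, hd]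
  rfl

/-! ### Central characters -/

/-- The class sum of `x` acts on an irreducible representation by the scalar `ω_χ`. It is the image
of an element of the ring `ℤG`, which is a finitely generated `ℤ`-module, so the scalar is
integral. -/
theorem isIntegral_centralCharValue {G : Type*} [Group G] [Finite G] {χ : G → ℂ}
    (hχ : χ ∈ Irr G) (x : G) : IsIntegral ℤ (centralCharValue χ (conjugatesOf x)) := by
  classical
  have := Fintype.ofFinite G
  obtain ⟨d, ρ, hρ, rfl⟩ := hχ
  set T : Finset G := (conjugatesOf x).toFinset with hT
  have hTmem : ∀ y, y ∈ T ↔ IsConj x y := fun y => by rw [hT, Set.mem_toFinset]; rfl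
  set K : Module.End ℂ (Fin d → ℂ) := ∑ y ∈ T, ρ y with hK
  have hcomm : ∀ g, K ∘ₗ ρ g = ρ g ∘ₗ K := fun g => by
    change K * ρ g = ρ g * K
    rw [hK, Finset.sum_mul, Finset.mul_sum]
    refine Finset.sum_bij' (fun y _ => g⁻¹ * y * g) (fun y _ => g * y * g⁻¹) ?_ ?_ ?_ ?_ ?_
    · intro y hy
      rw [hTmem] at hy ⊢
      exact hy.trans (isConj_iff.2 ⟨g⁻¹, by group⟩)
    · intro y hy
      rw [hTmem] at hy ⊢
      exact hy.trans (isConj_iff.2 ⟨g, rfl⟩)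
    · intro y _; group
    · intro y _; group
    · intro y _
      rw [← map_mul, ← map_mul]
      congr 1; group
  -- Schur's lemma: the class sum is central, so it acts by a scalar.
  obtain ⟨c, hc⟩ := Representation.IsIrreducible.algebraMap_intertwiningMap_bijective_of_isAlgClosed
    (ρ := ρ) |>.2 ⟨K, fun g => hcomm g⟩
  have hKc : K = algebraMap ℂ (Module.End ℂ (Fin d → ℂ)) c := by
    have := congrArg Representation.IntertwiningMap.toLinearMap hc
    rw [← show _ = K from this]
    rfl
  -- An irreducible representation is nonzero, so the division by `χ 1` is a genuine one.
  have hnt : Nontrivial (Fin d → ℂ) := by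
    by_contra h
    rw [not_nontrivial_iff_subsingleton] at h
    obtain ⟨a, b, hab⟩ := hρ.toNontrivial.exists_pair_ne
    exact hab (SetLike.ext fun v => by
      rw [Subsingleton.elim v 0]
      exact ⟨fun _ => b.toSubmodule.zero_mem, fun _ => a.toSubmodule.zero_mem⟩)
  have hd : (d : ℂ) ≠ 0 := by
    rintro h
    obtain rfl : d = 0 := by exact_mod_cast h
    exact not_subsingleton (Fin 0 → ℂ) inferInstance
  have hval : centralCharValue ρ.character (conjugatesOf x) = c := by
    have h1 : ∑ᶠ y ∈ conjugatesOf x, ρ.character y = LinearMap.trace ℂ _ K := by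
      rw [finsum_mem_eq_toFinset_sum, hK, map_sum]
      rfl
    rw [centralCharValue, h1, hKc, Representation.char_one, Algebra.algebraMap_eq_smul_one,
      map_smul, LinearMap.trace_one]
    simp [hd]
  rw [hval]
  have hint : IsIntegral ℤ K := by
    let φ : MonoidAlgebra ℤ G →ₐ[ℤ] Module.End ℂ (Fin d → ℂ) := MonoidAlgebra.lift ℤ _ G ρ
    have : φ (∑ y ∈ T, MonoidAlgebra.of ℤ G y) = K := by
      rw [map_sum, hK]
      exact Finset.sum_congr rfl fun y _ => by simp [φ]
    rw [← this]
    have : Module.Finite ℤ (MonoidAlgebra ℤ G) := inferInstance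
    exact (IsIntegral.of_finite ℤ _).map φ
  rw [hKc] at hint
  exact (isIntegral_algebraMap_iff (FaithfulSMul.algebraMap_injective ℂ _)).1 hint

theorem centralCharValue_comp {G : Type*} [Group G] [Finite G] (σ : ℂ ≃+* ℂ) (χ : G → ℂ)
    (T : Set G) : centralCharValue (σ ∘ χ) T = σ (centralCharValue χ T) := by
  rw [centralCharValue, centralCharValue, map_div₀]
  congr 1
  exact (AddMonoidHom.map_finsum_mem χ (σ : ℂ →+* ℂ).toAddMonoidHom (Set.toFinite T)).symm

theorem centralCharValue_mem {G : Type*} [Group G] {F : IntermediateField ℚ ℂ}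
    {χ : G → ℂ} (hχ : ∀ g, χ g ∈ F) (T : Set G) : centralCharValue χ T ∈ F :=
  div_mem (finsum_mem_induction (· ∈ F) (zero_mem _) (fun _ _ => add_mem) fun y _ => hχ y) (hχ 1)

/-! ### The action of the inertia group on blocks -/

theorem reducesToZero_coe {M : Ideal AlgInt} (hM : M ≠ ⊤) {r : AlgInt} (hr : r ∈ M) :
    ReducesToZero M r :=
  ⟨r, hr, 1, (Ideal.ne_top_iff_one M).1 hM, by simp⟩

theorem ReducesToZero.sub {M : Ideal AlgInt} [hM : M.IsPrime] {z w : ℂ}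
    (hz : ReducesToZero M z) (hw : ReducesToZero M w) : ReducesToZero M (z - w) := by
  obtain ⟨r, hr, s, hs, rfl⟩ := hz
  obtain ⟨r', hr', s', hs', rfl⟩ := hw
  refine ⟨r * s' - s * r', M.sub_mem (M.mul_mem_right _ hr) (M.mul_mem_left _ hr'), s * s',
    fun h => (hM.mem_or_mem h).elim hs hs', ?_⟩
  -- Denominators outside `M` are nonzero, since `0 ∈ M`.
  have h0 : ∀ t : AlgInt, t ∉ M → (t : ℂ) ≠ 0 := fun t ht h =>
    ht ((Subtype.ext h : t = 0) ▸ M.zero_mem)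
  push_cast
  rw [div_sub_div _ _ (h0 s hs) (h0 s' hs')]

/-- Elements of `Gal(ℚ_n / ℚ_m)` act trivially modulo `M` on the integers of `ℚ_n`. These form the
ring `ℤ[ζ]` with `ζ` a primitive `n`-th root of unity, and if `q` is the `p`-part of `n`, then
`ζ ^ q` is fixed, so that `(τ ζ - ζ) ^ q ≡ τ (ζ ^ q) - ζ ^ q = 0` in characteristic `p`. -/
theorem exists_mem_ideal_eq_sub {p n : ℕ} (hp : p.Prime) (hn : n ≠ 0) {M : Ideal AlgInt}
    [hM : M.IsMaximal] (hpM : (p : AlgInt) ∈ M) {τ : CycloGal n} (hτ : τ ∈ galI p n)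
    (z : cycloField n) (hz : IsIntegral ℤ z) :
    ∃ r ∈ M, (r : ℂ) = τ z - z := by
  have : NeZero n := ⟨hn⟩
  have : Fact p.Prime := ⟨hp⟩
  have hint : ∀ y : cycloField n, IsIntegral ℤ y → IsIntegral ℤ (y : ℂ) := fun y hy =>
    hy.map ((cycloField n).val.restrictScalars ℤ)
  have hintτ : ∀ y : cycloField n, IsIntegral ℤ y → IsIntegral ℤ (τ y) := fun y hy =>
    hy.map (τ.toAlgHom.restrictScalars ℤ)
  obtain ⟨ζ, hζ⟩ := (cycloField_isCyclotomicExtension n).1 rfl hn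
  have hζint : IsIntegral ℤ ζ := hζ.isIntegral (Nat.pos_of_ne_zero hn)
  have := IsCyclotomicExtension.Rat.isIntegralClosure_adjoin_singleton hζ
  obtain ⟨⟨w, hw⟩, rfl⟩ := (IsIntegralClosure.isIntegral_iff
    (A := Algebra.adjoin ℤ ({ζ} : Set (cycloField n)))).1 hz
  change ∃ r ∈ M, (r : ℂ) = τ w - w
  have key : IsIntegral ℤ w ∧ ∃ r ∈ M, (r : ℂ) = τ w - w := by
    clear hz
    induction hw using Algebra.adjoin_induction with
    | mem y hy =>
      obtain rfl : y = ζ := hy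
      refine ⟨hζint, ⟨(τ y : ℂ) - y, (hint _ (hintτ y hζint)).sub (hint y hζint)⟩, ?_, rfl⟩
      set q := p ^ padicValNat p n with hq
      have hfix : τ (y ^ q) = y ^ q := by
        refine hτ _ (mem_cycloField_of_pow_eq_one ?_ ?_)
        · exact (Nat.div_pos (Nat.le_of_dvd (Nat.pos_of_ne_zero hn) pow_padicValNat_dvd)
            (pow_pos hp.pos _)).ne'
        · have h : (y ^ q) ^ (n / q) = 1 := by
            rw [← pow_mul, Nat.mul_div_cancel' pow_padicValNat_dvd, hζ.pow_eq_one]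
          exact_mod_cast congrArg ((↑) : cycloField n → ℂ) h
      let a : AlgInt := ⟨(τ y : ℂ), hint _ (hintτ y hζint)⟩
      let b : AlgInt := ⟨(y : ℂ), hint y hζint⟩
      have hab : a ^ q = b ^ q := Subtype.ext (by
        have := congrArg ((↑) : cycloField n → ℂ) hfix
        rw [map_pow] at this
        change (τ y : ℂ) ^ q = (y : ℂ) ^ q
        exact_mod_cast this)
      change a - b ∈ M
      have : CharP (AlgInt ⧸ M) p := by
        refine (CharP.charP_iff_prime_eq_zero hp).2 ?_
        rw [← map_natCast (Ideal.Quotient.mk M)]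
        exact Ideal.Quotient.eq_zero_iff_mem.2 hpM
      rw [← Ideal.Quotient.eq_zero_iff_mem]
      refine pow_eq_zero_iff (n := q) (pow_pos hp.pos _).ne' |>.1 ?_
      rw [map_sub, hq, sub_pow_char_pow, ← hq, ← map_pow, ← map_pow, hab, sub_self]
    | algebraMap k =>
      exact ⟨isIntegral_algebraMap, 0, M.zero_mem, by simp⟩
    | add y w _ _ hy hw =>
      obtain ⟨hyi, r, hr, hry⟩ := hy
      obtain ⟨hwi, s, hs, hsw⟩ := hw
      refine ⟨hyi.add hwi, r + s, M.add_mem hr hs, ?_⟩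
      push_cast
      rw [hry, hsw, map_add]
      push_cast
      ring
    | mul y w _ _ hy hw =>
      obtain ⟨hyi, r, hr, hry⟩ := hy
      obtain ⟨hwi, s, hs, hsw⟩ := hw
      refine ⟨hyi.mul hwi, ⟨(τ y : ℂ), hint _ (hintτ y hyi)⟩ * s + r * ⟨(w : ℂ), hint w hwi⟩,
        M.add_mem (M.mul_mem_left _ hs) (M.mul_mem_right _ hr), ?_⟩
      push_cast
      rw [hry, hsw, map_mul]
      push_cast
      ring
  exact key.2

theorem IsBlock.subset_Irr {G : Type*} [Group G] {M : Ideal AlgInt} {B : Set (G → ℂ)}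
    (hB : IsBlock M B) : B ⊆ Irr G := by
  obtain ⟨χ, -, rfl⟩ := hB
  exact fun ψ hψ => hψ.1

/-- The inertia group fixes blocks, because it fixes central characters modulo `M`. -/
theorem IsBlock.galConj_mem {G : Type*} [Group G] [Finite G] {p : ℕ} (hp : p.Prime)
    {M : Ideal AlgInt} [hM : M.IsMaximal] (hpM : (p : AlgInt) ∈ M) {B : Set (G → ℂ)}
    (hB : IsBlock M B) {τ : CycloGal (Nat.card G)} (hτ : τ ∈ galI p (Nat.card G))
    {χ : G → ℂ} (hχ : χ ∈ B) : galConj τ χ ∈ B := by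
  have hn : Nat.card G ≠ 0 := Nat.card_pos.ne'
  have hχI := hB.subset_Irr hχ
  have hval := apply_mem_cycloField_of_mem_Irr hn (fun g : G => pow_card_eq_one') hχI
  obtain ⟨σ, hσ⟩ := exists_ringEquiv_extending τ
  have hconj := galConj_eq_comp hσ hval
  obtain ⟨χ₀, hχ₀, rfl⟩ := hB
  refine ⟨hconj ▸ comp_mem_Irr σ hχI, fun x => ?_⟩
  have hω := centralCharValue_mem hval (conjugatesOf x)
  obtain ⟨r, hr, hrω⟩ := exists_mem_ideal_eq_sub hp hn hpM hτ
    ⟨_, hω⟩ ((isIntegral_algHom_iff ((cycloField (Nat.card G)).val.restrictScalars ℤ)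
      Subtype.val_injective).1 (isIntegral_centralCharValue hχI x))
  have h := (hχ.2 x).sub (reducesToZero_coe hM.ne_top hr)
  rw [hrω, ← hσ] at h
  rw [hconj, centralCharValue_comp]
  convert h using 1
  ring

theorem IsBlock.galI_le_galHB {G : Type*} [Group G] [Finite G] {p : ℕ} (hp : p.Prime)
    {M : Ideal AlgInt} [M.IsMaximal] (hpM : (p : AlgInt) ∈ M) {B : Set (G → ℂ)}
    (hB : IsBlock M B) : galI p (Nat.card G) ≤ galHB p (Nat.card G) B := by
  refine fun τ hτ => ⟨(le_sup_left : galI p (Nat.card G) ≤ galH p (Nat.card G)) hτ,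
    Set.Subset.antisymm ?_ fun χ hχ => ?_⟩
  · rintro _ ⟨χ, hχ, rfl⟩
    exact hB.galConj_mem hp hpM hτ hχ
  · exact ⟨galConj τ⁻¹ χ, hB.galConj_mem hp hpM (inv_mem hτ) hχ, by
      rw [← galConj_mul, mul_inv_cancel, galConj_one]⟩

theorem IsBlock.galConj_mem_IrrZero {G : Type*} [Group G] [Finite G] {p : ℕ} (hp : p.Prime)
    {M : Ideal AlgInt} [M.IsMaximal] (hpM : (p : AlgInt) ∈ M) {B : Set (G → ℂ)}
    (hB : IsBlock M B) {τ : CycloGal (Nat.card G)} (hτ : τ ∈ galI p (Nat.card G))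
    {χ : G → ℂ} (hχ : χ ∈ IrrZero p B) : galConj τ χ ∈ IrrZero p B := by
  refine ⟨hB.galConj_mem hp hpM hτ hχ.1, ?_⟩
  rw [height, charDegree_galConj τ (hB.subset_Irr hχ.1)]
  exact hχ.2

/-! ### Levels and Galois stabilizers -/

/-- For a function with values in `ℚ_n`, being of level at most `e` means being fixed by
`Gal(ℚ_n / ℚ_k)`, where `k` is `p ^ e` times the `p'`-part of `n`. -/
theorem lev_le_iff_forall_galConj_eq {G : Type*} {p n : ℕ} (hp : p.Prime) (hn : n ≠ 0)
    {χ : G → ℂ} (hχ : ∀ g, χ g ∈ cycloField n) {e : ℕ} (he : e ≤ padicValNat p n) :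
    lev p χ ≤ e ↔ ∀ τ : CycloGal n,
      (∀ y : cycloField n, (y : ℂ) ∈ cycloField (p ^ e * (n / p ^ padicValNat p n)) → τ y = y) →
        galConj τ χ = χ := by
  have hdvd : p ^ e * (n / p ^ padicValNat p n) ∣ n := by
    conv_rhs => rw [← Nat.mul_div_cancel' (pow_padicValNat_dvd (p := p) (n := n))]
    exact mul_dvd_mul_right (pow_dvd_pow p he) _
  have hS : Set.range χ ⊆ cycloField n := by
    rintro _ ⟨g, rfl⟩
    exact hχ g
  rw [lev, padicValNat_charConductor_le_iff hp hn hS]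
  simp only [galConj_eq_self_iff _ hχ]
  refine ⟨?_, ?_⟩
  · intro h τ hτ g
    exact (mem_cycloField_iff_forall_fixed hn _ ⟨χ g, hχ g⟩).1 (h ⟨g, rfl⟩) τ hτ
  · rintro h _ ⟨g, rfl⟩
    exact (mem_cycloField_iff_forall_fixed hn _ ⟨χ g, hχ g⟩).2 fun τ hτ => h τ hτ g

theorem lev_le_padicValNat {G : Type*} {p n : ℕ} (hp : p.Prime) (hn : n ≠ 0)
    {χ : G → ℂ} (hχ : ∀ g, χ g ∈ cycloField n) : lev p χ ≤ padicValNat p n := by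
  rw [lev_le_iff_forall_galConj_eq hp hn hχ le_rfl]
  intro τ hτ
  rw [galConj_eq_self_iff τ hχ]
  refine fun g => hτ _ ?_
  rw [Nat.mul_div_cancel' pow_padicValNat_dvd]
  exact hχ g

/-- Functions with values in `ℚ_n` that have the same stabilizer in `Gal(ℚ_n / ℚ_m)` have the same
level. -/
theorem lev_eq_of_galConj_eq_iff {G H : Type*} {p n : ℕ} (hp : p.Prime) (hn : n ≠ 0)
    {χ : G → ℂ} (hχ : ∀ g, χ g ∈ cycloField n) {ψ : H → ℂ} (hψ : ∀ h, ψ h ∈ cycloField n)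
    (hstab : ∀ τ ∈ galI p n, galConj τ χ = χ ↔ galConj τ ψ = ψ) : lev p χ = lev p ψ := by
  have hdvd : p ^ padicValNat p n ∣ n := pow_padicValNat_dvd
  have hm : n / p ^ padicValNat p n ≠ 0 :=
    (Nat.div_pos (Nat.le_of_dvd (Nat.pos_of_ne_zero hn) hdvd) (pow_pos hp.pos _)).ne'
  have key : ∀ e ≤ padicValNat p n, lev p χ ≤ e ↔ lev p ψ ≤ e := fun e he => by
    rw [lev_le_iff_forall_galConj_eq hp hn hχ he, lev_le_iff_forall_galConj_eq hp hn hψ he]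
    refine forall_congr' fun τ => forall_congr' fun hτ => hstab τ fun y hy => hτ y ?_
    exact cycloField_le_of_dvd (mul_ne_zero (pow_pos hp.pos e).ne' hm) (Nat.dvd_mul_left _ _) hy
  exact le_antisymm ((key _ (lev_le_padicValNat hp hn hψ)).2 le_rfl)
    ((key _ (lev_le_padicValNat hp hn hχ)).1 le_rfl)

/-- Every bijection as in the Alperin–McKay–Navarro conjecture preserves levels. -/
theorem IsEquivariantBijection.lev_eq {G : Type*} [Group G] [Finite G] {p : ℕ} (hp : p.Prime)
    {M : Ideal AlgInt} [M.IsMaximal] (hpM : (p : AlgInt) ∈ M) {B : Set (G → ℂ)}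
    (hB : IsBlock M B) {D : Subgroup G} {b : Set (Subgroup.normalizer (D : Set G) → ℂ)}
    (hb : b ⊆ Irr (Subgroup.normalizer (D : Set G)))
    {f : (G → ℂ) → (Subgroup.normalizer (D : Set G) → ℂ)} (hf : IsEquivariantBijection p D B b f)
    {χ : G → ℂ} (hχ : χ ∈ IrrZero p B) : lev p χ = lev p (f χ) := by
  have hn : Nat.card G ≠ 0 := Nat.card_pos.ne'
  refine lev_eq_of_galConj_eq_iff hp hn
    (apply_mem_cycloField_of_mem_Irr hn (fun g => pow_card_eq_one') (hB.subset_Irr hχ.1))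
    (apply_mem_cycloField_of_mem_Irr hn (fun g => Subtype.ext (by simp))
      (hb (hf.1.mapsTo hχ).1)) fun τ hτ => ?_
  rw [← hf.2 τ (hB.galI_le_galHB hp hpM hτ) χ hχ]
  exact (hf.1.injOn.eq_iff (hB.galConj_mem_IrrZero hp hpM hτ hχ) hχ).symm

theorem combinedFor_of_AMNFor_of_levelFor {G : Type*} [Group G] [Finite G] {p : ℕ} (hp : p.Prime)
    {M : Ideal AlgInt} [M.IsMaximal] (hpM : (p : AlgInt) ∈ M) {B : Set (G → ℂ)}
    (hB : IsBlock M B) {D : Subgroup G} {b : Set (Subgroup.normalizer (D : Set G) → ℂ)}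
    (hb : b ⊆ Irr (Subgroup.normalizer (D : Set G))) (hA : AMNFor p D B b)
    (hL : LevelFor p D B) : CombinedFor p D B b := by
  obtain ⟨f, hf⟩ := hA
  exact ⟨f, hf, fun χ hχ h2 => (hL χ hχ h2).symm.trans (hf.lev_eq hp hpM hB hb hχ)⟩

theorem levelFor_of_combinedFor {G : Type*} [Group G] [Finite G] {p : ℕ} (hp : p.Prime)
    {M : Ideal AlgInt} [M.IsMaximal] (hpM : (p : AlgInt) ∈ M) {B : Set (G → ℂ)}
    (hB : IsBlock M B) {D : Subgroup G} {b : Set (Subgroup.normalizer (D : Set G) → ℂ)}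
    (hb : b ⊆ Irr (Subgroup.normalizer (D : Set G))) (hC : CombinedFor p D B b) :
    LevelFor p D B := by
  obtain ⟨f, hf, hlev⟩ := hC
  exact fun χ hχ h2 => (hf.lev_eq hp hpM hB hb hχ).trans (hlev χ hχ h2).symm

theorem brauerCorrespondent_subset_Irr {G : Type*} [Group G] (p : ℕ) (M : Ideal AlgInt)
    (D : Subgroup G) (B : Set (G → ℂ)) :
    brauerCorrespondent p M D B ⊆ Irr (Subgroup.normalizer (D : Set G)) := by
  rw [brauerCorrespondent]
  split_ifs with h
  · exact h.choose_spec.1.subset_Irr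
  · exact Set.empty_subset _

theorem mainTheorem11 :
    ((AMNConjecture.{u} ∧ LevelConjecture.{u} → CombinedConjecture.{u}) ∧
      (CombinedConjecture.{u} → LevelConjecture.{u})) ∧
    ∀ (p : ℕ) (_ : p.Prime) (M : Ideal AlgInt) (_ : M.IsMaximal) (_ : (p : AlgInt) ∈ M)
      (G : Type u) [Group G] [Finite G] (B : Set (G → ℂ)) (D : Subgroup G)
      (b : Set (Subgroup.normalizer (D : Set G) → ℂ)),
      IsBlock M B → IsDefectGroup p M B D → IsBrauerCorrespondent p M D B b →
        (AMNFor p D B b ∧ LevelFor p D B → CombinedFor p D B b) ∧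
        (CombinedFor p D B b → LevelFor p D B) := by
  refine ⟨⟨fun h p hp M hM hpM G _ _ B D hB hD => ?_, fun h p hp M hM hpM G _ _ B D hB hD => ?_⟩,
    fun p hp M hM hpM G _ _ B D b hB _ hb =>
      ⟨fun h => combinedFor_of_AMNFor_of_levelFor hp hpM hB hb.1.subset_Irr h.1 h.2,
        levelFor_of_combinedFor hp hpM hB hb.1.subset_Irr⟩⟩
  · exact combinedFor_of_AMNFor_of_levelFor hp hpM hB (brauerCorrespondent_subset_Irr p M D B)
      (h.1 p hp M hM hpM G B D hB hD) (h.2 p hp M hM hpM G B D hB hD)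
  · exact levelFor_of_combinedFor hp hpM hB (brauerCorrespondent_subset_Irr p M D B)
      (h p hp M hM hpM G B D hB hD)
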